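/- Let $A$ be a unital C*-algebra, $G$ a discrete group, and let $\alpha\colon G\to\mathrm{Aut}(A)$, $\sigma\colon G\times G\to\mathcal U(A)$ be a twisted action, i.e. $\alpha_r\alpha_s=\mathrm{Ad}(\sigma(r,s))\,\alpha_{rs}$, $\sigma(r,s)\sigma(rs,t)=\alpha_r(\sigma(s,t))\sigma(r,st)$ and $\sigma(s,1)=\sigma(1,s)=1$ for all $r,s,t\in G$. "Ideal" means closed two-sided ideal. Given a faithful representation $A\subset B(H)$ on a Hilbert space, the reduced twisted crossed product $A\rtimes_{\alpha,r}^\sigma G$ is the C*-subalgebra of $B(H\otimes\ell^2(G))$ generated by the operators $\pi_\alpha(a)(\xi\otimes\delta_t)=\alpha_{t^{-1}}(a)\xi\otimes\delta_t$ $(a\in A)$ and $\lambda_\sigma(g)(\xi\otimes\delta_t)=\sigma(t^{-1}g^{-1},g)\xi\otimes\delta_{gt}$ $(g\in G)$; identify $A$ with $\pi_\alpha(A)$, and let $E\colon A\rtimes_{\alpha,r}^\sigma G\to A$ be the canonical conditional expectation, with $E(\lambda_\sigma(g))=0$ for $g\ne1$. For a $G$-invariant ideal $I$ of $A$, let $I\rtimes_{\alpha,r}^\sigma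 G$ be the ideal of $A\rtimes_{\alpha,r}^\sigma G$ generated by $I$, and let $I\bar\rtimes_{\alpha,r}^\sigma G$ be the kernel of the *-homomorphism $A\rtimes_{\alpha,r}^\sigma G\to (A/I)\rtimes_{\dot\alpha,r}^{\dot\sigma}G$ induced by the quotient map $A\to A/I$, where $(\dot\alpha,\dot\sigma)$ is the twisted action induced on $A/I$. Assume that 1. $\alpha_g=\mathrm{id}_A$ for all $g\in G$ (so that every ideal of $A$ is $G$-invariant); 2. the system is exact: $I\rtimes_{\alpha,r}^\sigma G=I\bar\rtimes_{\alpha,r}^\sigma G$ for every $G$-invariant ideal $I$ of $A$; 3. the system has Powers' averaging property: for every $b\in A\rtimes_{\alpha,r}^\sigma G$ with $E(b)=0$ and every $\varepsilon>0$ there are $n\ge1$ and $g_1,\dots,g_n\in G$ with $\bigl\|\frac1n\sum_{i=1}^n\lambda_\sigma(g_i)\,b\,\lambda_\sigma(g_i)^*\bigr\|<\varepsilon$. Then $Y\mapsto Y\bar\rtimes_{\alpha,r}^\sigma G$ is a bijection from the set of ideals of $A$ onto the set of ideals of $A\rtimes_{\alpha,r}^\sigma G$. -/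

import Mathlib

open scoped ENNReal

set_option linter.unusedSectionVars false

noncomputable section

namespace TwistedCrossed

section Representations

variable {A : Type*} [CStarAlgebra A]

/-- The direct sum of a family of representations of a C*-algebra on Hilbert spaces. -/
def directSumRep {ι : Type*} {H : ι → Type*} [∀ i, NormedAddCommGroup (H i)]
    [∀ i, InnerProductSpace ℂ (H i)] [∀ i, CompleteSpace (H i)]
    (ρ : ∀ i, A →⋆ₐ[ℂ] (H i →L[ℂ] H i)) :
    A →⋆ₐ[ℂ] (lp H 2 →L[ℂ] lp H 2) where
  toFun a := lp.mapCLM 2 (fun i => ρ i a) (norm_nonneg a)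
    (fun i => NonUnitalStarAlgHom.norm_apply_le (ρ i) a)
  map_one' := by ext ξ i; simp
  map_mul' a b := by ext ξ i; simp
  map_zero' := by ext ξ i; simp
  map_add' a b := by ext ξ i; simp
  commutes' r := by ext ξ i; simp [Algebra.algebraMap_eq_smul_one]
  map_star' a := by
    rw [ContinuousLinearMap.star_eq_adjoint, ContinuousLinearMap.eq_adjoint_iff]
    intro x y
    simp [lp.inner_eq_tsum, map_star, ContinuousLinearMap.star_eq_adjoint,
      ContinuousLinearMap.adjoint_inner_left]

@[simp] lemma directSumRep_apply {ι : Type*} {H : ι → Type*} [∀ i, NormedAddCommGroup (H i)]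
    [∀ i, InnerProductSpace ℂ (H i)] [∀ i, CompleteSpace (H i)]
    (ρ : ∀ i, A →⋆ₐ[ℂ] (H i →L[ℂ] H i)) (a : A) (ξ : lp H 2) (i : ι) :
    directSumRep ρ a ξ i = ρ i a (ξ i) := rfl

variable (A) in
/-- A faithful representation of the C*-algebra `A` on the Hilbert space `H`. -/
structure FaithfulRep (H : Type*) [NormedAddCommGroup H] [InnerProductSpace ℂ H]
    [CompleteSpace H] where
  toHom : A →⋆ₐ[ℂ] (H →L[ℂ] H)
  injective : Function.Injective toHom

attribute [local instance] CStarAlgebra.spectralOrder CStarAlgebra.spectralOrderedRing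
open scoped ComplexOrder

lemma exists_positive_ne_zero (a : A) (ha : a ≠ 0) :
    ∃ φ : A →ₚ[ℂ] ℂ, φ (star a * a) ≠ 0 := by
  have hb : (0 : A) ≤ star a * a := star_mul_self_nonneg a
  have hb0 : star a * a ≠ 0 := by simpa using ha
  let C : ProperCone ℝ A :=
    { carrier := {x | 0 ≤ x}
      add_mem' := fun {x y} (h : 0 ≤ x) (h' : 0 ≤ y) => show 0 ≤ x + y from add_nonneg h h'
      zero_mem' := le_refl (0 : A)
      smul_mem' := fun c x h => smul_nonneg (α := ℝ) (β := A) c.2 h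
      isClosed' := CStarAlgebra.isClosed_nonneg }
  have hC : ∀ x, x ∈ C ↔ 0 ≤ x := fun x => Iff.rfl
  have hnot : -(star a * a) ∉ C := by
    rw [hC]
    intro h
    exact hb0 (le_antisymm (by simpa using h) hb)
  obtain ⟨f, hf, hf0⟩ := C.hyperplane_separation_point hnot
  let ψ : A →ₗ[ℂ] ℂ :=
    { toFun := fun x => (f (realPart x : A) : ℂ) + Complex.I * (f (imaginaryPart x : A) : ℂ)
      map_add' := fun x y => by simp; ring
      map_smul' := fun c x => by
        simp only [realPart_smul, imaginaryPart_smul]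
        simp
        linear_combination
          (f (realPart x : A) + Complex.I * (f (imaginaryPart x : A) : ℂ)) * (Complex.re_add_im c) + (-(c.im : ℂ) * f (imaginaryPart x : A)) *
          Complex.I_mul_I }
  have hψ : ∀ x, IsSelfAdjoint x → ψ x = f x := fun x hx => by
    simp [ψ, hx.coe_realPart, hx.imaginaryPart]
  refine ⟨PositiveLinearMap.mk₀ ψ fun x hx => ?_, ?_⟩
  · rw [hψ x (.of_nonneg hx)]
    exact_mod_cast hf x hx
  · change ψ _ ≠ 0
    rw [hψ _ (.of_nonneg hb)]
    rw [map_neg] at hf0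
    exact_mod_cast (by linarith : 0 < f (star a * a)).ne'

variable (A) in
/-- The Hilbert space of the universal representation of `A`: the Hilbert direct sum of the
GNS spaces of all positive linear functionals on `A`. -/
abbrev UniversalSpace : Type _ := lp (fun φ : A →ₚ[ℂ] ℂ => φ.GNS) 2

variable (A) in
/-- The universal representation of `A`, the direct sum of all its GNS representations. -/
def universalRep : FaithfulRep A (UniversalSpace A) where
  toHom := directSumRep fun φ : A →ₚ[ℂ] ℂ => φ.gnsStarAlgHom
  injective := by
    rw [injective_iff_map_eq_zero]
    intro a ha
    by_contra h
    obtain ⟨φ, hφ⟩ := exists_positive_ne_zero a h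
    classical
    have h1 := congrArg (fun T => (T (lp.single 2 φ ((φ.toPreGNS 1 : φ.PreGNS) : φ.GNS))) φ) ha
    simp at h1
    have h2 : ‖φ.toPreGNS a‖ ^ 2 = 0 := by
      rw [← UniformSpace.Completion.norm_coe, h1]; simp
    have h3 := φ.preGNS_norm_sq (φ.toPreGNS a)
    rw [← Complex.ofReal_pow, h2] at h3
    exact hφ (by simpa using h3.symm)

end Representations

/-- A closed two-sided ideal (in C*-algebras, simply called an ideal). -/
@[ext]
structure ClosedIdeal (R : Type*) [Ring R] [TopologicalSpace R] where
  toIdeal : Ideal R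
  twoSided : toIdeal.IsTwoSided
  closed : IsClosed (toIdeal : Set R)

namespace ClosedIdeal

instance {R : Type*} [Ring R] [TopologicalSpace R] : SetLike (ClosedIdeal R) R where
  coe I := (I.toIdeal : Set R)
  coe_injective I J h := by
    ext x
    exact Set.ext_iff.mp h x

variable {A : Type*} [CStarAlgebra A] (I : ClosedIdeal A)

instance : I.toIdeal.IsTwoSided := I.twoSided
instance : IsClosed (I.toIdeal : Set A) := I.closed

section
attribute [local instance] CStarAlgebra.spectralOrder CStarAlgebra.spectralOrderedRing

lemma norm_mul_cfc_le (x : A) {δ : ℝ} (hδ : 0 < δ) :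
    ‖x * cfc (fun t : ℝ => δ / (δ + t)) (star x * x)‖ ^ 2 ≤ δ := by
  have hpos : ∀ t ∈ spectrum ℝ (star x * x), 0 ≤ t := fun t ht =>
    spectrum_nonneg_of_nonneg (star_mul_self_nonneg x) ht
  have hc : ContinuousOn (fun t : ℝ => δ / (δ + t)) (spectrum ℝ (star x * x)) := by
    refine ContinuousOn.div (by fun_prop) (by fun_prop) fun t ht => ?_
    have := hpos t ht
    positivity
  have hsa : star (cfc (fun t : ℝ => δ / (δ + t)) (star x * x)) =
      cfc (fun t : ℝ => δ / (δ + t)) (star x * x) := (cfc_predicate (p := IsSelfAdjoint) _ _)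
  rw [sq, ← CStarRing.norm_star_mul_self, star_mul, hsa]
  have : cfc (fun t : ℝ => δ / (δ + t)) (star x * x) * star x *
      (x * cfc (fun t : ℝ => δ / (δ + t)) (star x * x)) =
      cfc (fun t : ℝ => δ / (δ + t) * t * (δ / (δ + t))) (star x * x) := by
    rw [cfc_mul _ _ _ (by fun_prop) hc, cfc_mul _ _ _ hc (by fun_prop), cfc_id' ℝ (star x * x)]
    noncomm_ring
  rw [this]
  refine norm_cfc_le hδ.le fun t ht => ?_
  have h0 := hpos t ht
  rw [Real.norm_of_nonneg (by positivity)]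
  have : δ / (δ + t) * t * (δ / (δ + t)) = δ * ((δ * t) / (δ + t) ^ 2) := by
    field_simp
  rw [this]
  apply mul_le_of_le_one_right hδ.le
  rw [div_le_one (by positivity)]
  nlinarith

/-- Approximate units of closed ideals. -/
lemma exists_approx_unit {x : A} (hx : x ∈ I.toIdeal) {ε : ℝ} (hε : 0 < ε) :
    ∃ e ∈ I.toIdeal, IsSelfAdjoint e ∧ ‖1 - e‖ ≤ 1 ∧ ‖x * (1 - e)‖ < ε := by
  let δ := (ε / 2) ^ 2
  have hδ : 0 < δ := by positivity
  have hpos : ∀ t ∈ spectrum ℝ (star x * x), 0 ≤ t := fun t ht =>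
    spectrum_nonneg_of_nonneg (star_mul_self_nonneg x) ht
  have hc : ContinuousOn (fun t : ℝ => 1 / (δ + t)) (spectrum ℝ (star x * x)) := by
    refine ContinuousOn.div (by fun_prop) (by fun_prop) fun t ht => ?_
    have := hpos t ht
    positivity
  have key : 1 - cfc (fun t : ℝ => 1 / (δ + t) * t) (star x * x) =
      cfc (fun t : ℝ => δ / (δ + t)) (star x * x) := by
    rw [← cfc_one ℝ (star x * x), ← cfc_sub (1 : ℝ → ℝ) (fun t : ℝ => 1 / (δ + t) * t) (star x * x)
      continuousOn_const (hc.mul (by fun_prop))]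
    refine cfc_congr fun t ht => ?_
    have := hpos t ht
    have : δ + t ≠ 0 := by positivity
    simp only [Pi.one_apply]
    field_simp
    ring
  refine ⟨cfc (fun t : ℝ => 1 / (δ + t) * t) (star x * x), ?_,
    cfc_predicate (p := IsSelfAdjoint) _ _, ?_, ?_⟩
  · rw [cfc_mul _ _ _ hc (by fun_prop), cfc_id' ℝ (star x * x)]
    exact I.toIdeal.mul_mem_left _ (I.toIdeal.mul_mem_left _ hx)
  · rw [key]
    refine norm_cfc_le zero_le_one fun t ht => ?_
    have := hpos t ht
    rw [Real.norm_of_nonneg (by positivity)]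
    rw [div_le_one (by positivity)]
    linarith
  · rw [key]
    have h := norm_mul_cfc_le x hδ
    have h2 := abs_le_of_sq_le_sq h (by positivity)
    rw [abs_of_nonneg (norm_nonneg _)] at h2
    linarith

end

lemma star_mem {x : A} (hx : x ∈ I.toIdeal) : star x ∈ I.toIdeal := by
  have : star x ∈ closure (I.toIdeal : Set A) := by
    rw [Metric.mem_closure_iff]
    intro ε hε
    obtain ⟨e, he, hsa, -, h⟩ := I.exists_approx_unit hx hε
    refine ⟨e * star x, I.toIdeal.mul_mem_right _ he, ?_⟩
    rw [dist_eq_norm, ← norm_star]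
    simpa [mul_sub, hsa.star_eq] using h
  rwa [I.closed.closure_eq] at this

/-- The quotient C*-algebra of `A` by a closed ideal. -/
abbrev Quot : Type _ := A ⧸ I.toIdeal

instance : NormedRing I.Quot where
  __ := Ideal.Quotient.ring I.toIdeal
  __ := Submodule.Quotient.normedAddCommGroup I.toIdeal
  norm_mul_le x y := by
    refine le_of_forall_pos_le_add fun ε hε => ?_
    have := ((Metric.nhds_basis_ball.prod_nhds Metric.nhds_basis_ball).tendsto_iff
      Metric.nhds_basis_ball).mp (continuous_mul.tendsto (‖x‖, ‖y‖)) ε hε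
    simp only [Set.mem_prod, Metric.mem_ball, and_imp, Prod.forall, Prod.exists] at this
    rcases this with ⟨ε₁, ε₂, ⟨h₁, h₂⟩, h⟩
    obtain ⟨a, rfl, ha⟩ := Submodule.Quotient.norm_mk_lt x h₁
    obtain ⟨b, rfl, hb⟩ := Submodule.Quotient.norm_mk_lt y h₂
    simp only [dist, abs_sub_lt_iff] at h
    have ha' := Submodule.Quotient.norm_mk_le I.toIdeal a
    have hb' := Submodule.Quotient.norm_mk_le I.toIdeal b
    specialize h ‖a‖ ‖b‖ ⟨by linarith, by linarith⟩ ⟨by linarith, by linarith⟩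
    calc
      _ ≤ ‖a‖ * ‖b‖ :=
        (Submodule.Quotient.norm_mk_le I.toIdeal (a * b)).trans (norm_mul_le a b)
      _ ≤ _ := (sub_lt_iff_lt_add'.mp h.1).le

instance : NormedAlgebra ℂ I.Quot where
  __ := Ideal.Quotient.algebra ℂ
  norm_smul_le := norm_smul_le

instance : StarRing I.Quot where
  star := Quotient.map' star fun a b h => by
    rw [Submodule.quotientRel_def] at h ⊢
    simpa using I.star_mem h
  star_involutive := by
    rintro ⟨x⟩
    exact congrArg (Ideal.Quotient.mk I.toIdeal) (star_star x)
  star_mul := by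
    rintro ⟨x⟩ ⟨y⟩
    exact congrArg (Ideal.Quotient.mk I.toIdeal) (star_mul x y)
  star_add := by
    rintro ⟨x⟩ ⟨y⟩
    exact congrArg (Ideal.Quotient.mk I.toIdeal) (star_add x y)

instance : CStarAlgebra I.Quot where
  norm_mul_self_le := by
    rintro ⟨a⟩
    change ‖Ideal.Quotient.mk I.toIdeal a‖ * ‖Ideal.Quotient.mk I.toIdeal a‖ ≤
      ‖(Submodule.Quotient.mk (star a * a) : A ⧸ I.toIdeal)‖
    refine le_of_forall_pos_le_add fun ε hε => ?_
    obtain ⟨m, hm, hmn⟩ := Submodule.Quotient.norm_mk_lt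
      (Submodule.Quotient.mk (star a * a) : A ⧸ I.toIdeal) (half_pos hε)
    rw [Submodule.Quotient.eq] at hm
    obtain ⟨e, he, hsa, h1, h2⟩ := I.exists_approx_unit hm (half_pos hε)
    have hle : ‖Ideal.Quotient.mk I.toIdeal a‖ ≤ ‖a * (1 - e)‖ := by
      have : Ideal.Quotient.mk I.toIdeal a = Ideal.Quotient.mk I.toIdeal (a * (1 - e)) := by
        rw [Ideal.Quotient.eq]
        simpa [mul_sub] using I.toIdeal.mul_mem_left a he
      rw [this]
      exact Submodule.Quotient.norm_mk_le I.toIdeal _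
    have hs : star (1 - e) = 1 - e := by simp [hsa.star_eq]
    calc _ ≤ ‖a * (1 - e)‖ * ‖a * (1 - e)‖ := by gcongr
      _ = ‖(1 - e) * m * (1 - e) - (1 - e) * ((m - star a * a) * (1 - e))‖ := by
        rw [← CStarRing.norm_star_mul_self, star_mul, hs]
        congr 1
        noncomm_ring
      _ ≤ ‖(1 - e) * m * (1 - e)‖ + ‖(1 - e) * ((m - star a * a) * (1 - e))‖ := norm_sub_le _ _
      _ ≤ 1 * ‖m‖ * 1 + 1 * ‖(m - star a * a) * (1 - e)‖ := by
        gcongr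
        · exact (norm_mul_le _ _).trans (by gcongr; exact (norm_mul_le _ _).trans (by gcongr))
        · exact (norm_mul_le _ _).trans (by gcongr)
      _ ≤ _ := by linarith
  star_smul := by
    rintro c ⟨x⟩
    exact congrArg (Ideal.Quotient.mk I.toIdeal) (star_smul c x)

/-- The quotient map `A → A/I`. -/
def proj : A →⋆ₐ[ℂ] I.Quot where
  __ := Ideal.Quotient.mkₐ ℂ I.toIdeal
  map_star' _ := rfl

lemma proj_surjective : Function.Surjective I.proj := Ideal.Quotient.mk_surjective

lemma proj_eq_zero_iff {a : A} : I.proj a = 0 ↔ a ∈ I := Ideal.Quotient.eq_zero_iff_mem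

/-- A *-homomorphism vanishing on `I` factors through `A/I`. -/
def lift {B : Type*} [CStarAlgebra B] (f : A →⋆ₐ[ℂ] B) (hf : ∀ a ∈ I, f a = 0) :
    I.Quot →⋆ₐ[ℂ] B where
  __ := Ideal.Quotient.liftₐ I.toIdeal f.toAlgHom hf
  map_star' := by
    rintro ⟨x⟩
    exact map_star f x

@[simp] lemma lift_proj {B : Type*} [CStarAlgebra B] (f : A →⋆ₐ[ℂ] B) (hf : ∀ a ∈ I, f a = 0)
    (a : A) : I.lift f hf (I.proj a) = f a := rfl

end ClosedIdeal

/-- A twisted C*-dynamical system `(A, G, α, σ)` over the discrete group `G`. -/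
structure TwistedSystem (A G : Type*) [CStarAlgebra A] [Group G] where
  α : G → (A ≃⋆ₐ[ℂ] A)
  σ : G → G → unitary A
  α_comp : ∀ r s a, α r (α s a) = (σ r s : A) * α (r * s) a * star (σ r s : A)
  cocycle : ∀ r s t,
    (σ r s : A) * (σ (r * s) t : A) = α r (σ s t : A) * (σ r (s * t) : A)
  σ_one_right : ∀ s, σ s 1 = 1
  σ_one_left : ∀ s, σ 1 s = 1

namespace TwistedSystem

variable {A G : Type*} [CStarAlgebra A] [Group G] (S : TwistedSystem A G)

/-- The action `α` is trivial: `α g` is the identity for all `g`. -/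
def IsTrivialAction : Prop := ∀ g a, S.α g a = a

/-- `G`-invariance of a closed ideal of `A`. -/
def IsInvariant (I : ClosedIdeal A) : Prop := ∀ g, ∀ a ∈ I, S.α g a ∈ I

lemma α_one (a : A) : S.α 1 a = a := by
  have h := S.α_comp 1 1 a
  rw [S.σ_one_left, mul_one] at h
  exact (S.α 1).injective (by simpa using h)

lemma IsTrivialAction.isInvariant {S : TwistedSystem A G} (h : S.IsTrivialAction)
    (I : ClosedIdeal A) : S.IsInvariant I := fun g a ha => by rwa [h g a]

lemma IsInvariant.symm_mem {S : TwistedSystem A G} {I : ClosedIdeal A} (h : S.IsInvariant I)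
    (g : G) {a : A} (ha : a ∈ I) : (S.α g).symm a ∈ I := by
  have key : (S.α g).symm a = S.α g⁻¹ (star (S.σ g g⁻¹ : A) * a * (S.σ g g⁻¹ : A)) := by
    apply (S.α g).injective
    change S.α g ((S.α g).symm a) = S.α g _
    rw [S.α_comp, mul_inv_cancel, S.α_one]
    simp only [StarAlgEquiv.apply_symm_apply]
    have h1 : (S.σ g g⁻¹ : A) * star (S.σ g g⁻¹ : A) = 1 := Unitary.coe_mul_star_self _
    calc a = 1 * a * 1 := by simp
      _ = _ := by rw [← h1]; noncomm_ring
  rw [key]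
  exact h _ _ (I.toIdeal.mul_mem_right _ (I.toIdeal.mul_mem_left _ ha))

/-- The twisted action induced on `A/I` by a `G`-invariant ideal `I`. -/
def quotient (I : ClosedIdeal A) (hI : S.IsInvariant I) : TwistedSystem I.Quot G where
  α g :=
    StarAlgEquiv.ofStarAlgHom
      (I.lift (I.proj.comp (S.α g : A →⋆ₐ[ℂ] A)) fun a ha => I.proj_eq_zero_iff.2 (hI g a ha))
      (I.lift (I.proj.comp ((S.α g).symm : A →⋆ₐ[ℂ] A))
        fun a ha => I.proj_eq_zero_iff.2 (hI.symm_mem g ha))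
      (by
        ext x
        obtain ⟨a, rfl⟩ := I.proj_surjective x
        exact congrArg I.proj ((S.α g).symm_apply_apply a))
      (by
        ext x
        obtain ⟨a, rfl⟩ := I.proj_surjective x
        exact congrArg I.proj ((S.α g).apply_symm_apply a))
  σ r s := ⟨I.proj (S.σ r s), Unitary.map_mem I.proj (S.σ r s).2⟩
  α_comp r s x := by
    obtain ⟨a, rfl⟩ := I.proj_surjective x
    have := congrArg I.proj (S.α_comp r s a)
    simp only [map_mul, map_star] at this
    exact this
  cocycle r s t := by
    have := congrArg I.proj (S.cocycle r s t)
    simp only [map_mul] at this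
    exact this
  σ_one_right s := Subtype.ext (by simp [S.σ_one_right])
  σ_one_left s := Subtype.ext (by simp [S.σ_one_left])

@[simp] lemma quotient_α_proj (I : ClosedIdeal A) (hI : S.IsInvariant I) (g : G) (a : A) :
    (S.quotient I hI).α g (I.proj a) = I.proj (S.α g a) := rfl

@[simp] lemma quotient_σ_coe (I : ClosedIdeal A) (hI : S.IsInvariant I) (r s : G) :
    ((S.quotient I hI).σ r s : I.Quot) = I.proj (S.σ r s) := rfl

section CrossedProduct

variable {H : Type*} [NormedAddCommGroup H] [InnerProductSpace ℂ H] [CompleteSpace H]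

/-- The Hilbert space `ℓ²(G, H)`, a model of `H ⊗ ℓ²(G)` in which `ξ ⊗ δ_t` is
`lp.single 2 t ξ`. -/
abbrev L2 (G H : Type*) [NormedAddCommGroup H] : Type _ := lp (fun _ : G => H) 2

/-- The representation `π_α` of `A` on `H ⊗ ℓ²(G)`,
`π_α(a)(ξ ⊗ δ_t) = α_{t⁻¹}(a) ξ ⊗ δ_t`. -/
def piRep (ρ : FaithfulRep A H) : A →⋆ₐ[ℂ] (L2 G H →L[ℂ] L2 G H) :=
  directSumRep fun t : G => ρ.toHom.comp (S.α t⁻¹ : A →⋆ₐ[ℂ] A)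

lemma piRep_apply (ρ : FaithfulRep A H) (a : A) (ξ : L2 G H) (t : G) :
    S.piRep ρ a ξ t = ρ.toHom (S.α t⁻¹ a) (ξ t) := rfl

lemma norm_rep_unitary (ρ : FaithfulRep A H) (u : unitary A) (ξ : H) :
    ‖ρ.toHom u ξ‖ = ‖ξ‖ := by
  exact (Unitary.linearIsometryEquiv
    ⟨ρ.toHom u, Unitary.map_mem ρ.toHom u.2⟩).norm_map ξ

/-- The operator `λ_σ(g)` on `H ⊗ ℓ²(G)`,
`λ_σ(g)(ξ ⊗ δ_t) = σ(t⁻¹g⁻¹, g) ξ ⊗ δ_{gt}`. -/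
def lam (ρ : FaithfulRep A H) (g : G) : L2 G H →L[ℂ] L2 G H :=
  LinearMap.mkContinuous
    { toFun := fun ξ => ⟨fun t => ρ.toHom (S.σ t⁻¹ g : A) (ξ (g⁻¹ * t)), by
        have h := (lp.memℓp ξ).summable (by norm_num)
        refine memℓp_gen ?_
        simp only [norm_rep_unitary]
        exact (Equiv.mulLeft g⁻¹).summable_iff.mpr h⟩
      map_add' := fun ξ η => by ext t; exact map_add _ _ _
      map_smul' := fun c ξ => by ext t; exact map_smul _ _ _ }
    1 fun ξ => by
      rw [one_mul]
      refine lp.norm_le_of_tsum_le (by norm_num) (norm_nonneg _) ?_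
      rw [lp.norm_rpow_eq_tsum (by norm_num)]
      simp only [LinearMap.coe_mk, AddHom.coe_mk, norm_rep_unitary]
      exact ((Equiv.mulLeft g⁻¹).tsum_eq (fun t => ‖ξ t‖ ^ (2 : ℝ≥0∞).toReal)).le

lemma lam_apply (ρ : FaithfulRep A H) (g : G) (ξ : L2 G H) (t : G) :
    S.lam ρ g ξ t = ρ.toHom (S.σ t⁻¹ g : A) (ξ (g⁻¹ * t)) := rfl

lemma piRep_single [DecidableEq G] (ρ : FaithfulRep A H) (a : A) (t : G) (ξ : H) :
    S.piRep ρ a (lp.single 2 t ξ) = lp.single 2 t (ρ.toHom (S.α t⁻¹ a) ξ) := by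
  ext s
  rw [piRep_apply]
  by_cases h : s = t
  · subst h; simp
  · simp [h]

lemma lam_single [DecidableEq G] (ρ : FaithfulRep A H) (g t : G) (ξ : H) :
    S.lam ρ g (lp.single 2 t ξ) =
      lp.single 2 (g * t) (ρ.toHom (S.σ (t⁻¹ * g⁻¹) g : A) ξ) := by
  ext s
  rw [lam_apply]
  by_cases h : s = g * t
  · subst h; simp
  · have : g⁻¹ * s ≠ t := fun h' => h (by simp [← h'])
    simp [h, this]

/-- The generators `π_α(a)`, `a ∈ A`, and `λ_σ(g)`, `g ∈ G`, of the reduced crossed product. -/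
def generators (ρ : FaithfulRep A H) : Set (L2 G H →L[ℂ] L2 G H) :=
  Set.range (S.piRep ρ) ∪ Set.range (S.lam ρ)

/-- The reduced twisted crossed product, realized through the faithful representation `ρ` as the
C*-subalgebra of `B(H ⊗ ℓ²(G))` generated by `π_α(A)` and `λ_σ(G)`. -/
def reducedCrossedProduct (ρ : FaithfulRep A H) :
    StarSubalgebra ℂ (L2 G H →L[ℂ] L2 G H) :=
  (StarAlgebra.adjoin ℂ (S.generators ρ)).topologicalClosure

/-- The reduced twisted crossed product as a type. -/
abbrev Crossed (ρ : FaithfulRep A H) : Type _ := S.reducedCrossedProduct ρ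

instance (ρ : FaithfulRep A H) :
    IsClosed (S.reducedCrossedProduct ρ : Set (L2 G H →L[ℂ] L2 G H)) :=
  StarSubalgebra.isClosed_topologicalClosure _

/-- The embedding `π_α` of `A` into the reduced crossed product. -/
def incl (ρ : FaithfulRep A H) : A →⋆ₐ[ℂ] S.Crossed ρ :=
  (S.piRep ρ).codRestrict _ fun a =>
    StarSubalgebra.le_topologicalClosure _
      (StarAlgebra.subset_adjoin ℂ _ (Or.inl ⟨a, rfl⟩))

/-- The element `λ_σ(g)` of the reduced crossed product. -/
def lamElem (ρ : FaithfulRep A H) (g : G) : S.Crossed ρ :=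
  ⟨S.lam ρ g, StarSubalgebra.le_topologicalClosure _
    (StarAlgebra.subset_adjoin ℂ _ (Or.inr ⟨g, rfl⟩))⟩

open Classical in
/-- The `(s, t)` matrix coefficient of an operator on `ℓ²(G, H)`. -/
def coeff (s t : G) (x : L2 G H →L[ℂ] L2 G H) : H →L[ℂ] H :=
  (lp.evalCLM ℂ (fun _ : G => H) 2 s) ∘L x ∘L
    (lp.singleContinuousLinearMap ℂ (fun _ : G => H) 2 t)

open Classical in
lemma coeff_apply (s t : G) (x : L2 G H →L[ℂ] L2 G H) (ξ : H) :
    coeff s t x ξ = x (lp.single 2 t ξ) s := rfl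

lemma continuous_coeff (s t : G) : Continuous (coeff (H := H) s t) := by
  unfold coeff
  fun_prop

lemma coeff_add (s t : G) (x y : L2 G H →L[ℂ] L2 G H) :
    coeff s t (x + y) = coeff s t x + coeff s t y := rfl

lemma coeff_smul (s t : G) (c : ℂ) (x : L2 G H →L[ℂ] L2 G H) :
    coeff s t (c • x) = c • coeff s t x := rfl

lemma eq_zero_of_coeff (x : L2 G H →L[ℂ] L2 G H) (h : ∀ s t, coeff s t x = 0) : x = 0 := by
  classical
  ext ξ : 1
  have h1 := (lp.hasSum_single (by norm_num) ξ).mapL x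
  have h2 : (fun t => x (lp.single 2 t (ξ t))) = fun _ => 0 := by
    funext t
    ext s
    rw [← coeff_apply, h]
    rfl
  rw [h2] at h1
  exact h1.unique hasSum_zero

lemma coeff_mul_piRep (ρ : FaithfulRep A H) (x : L2 G H →L[ℂ] L2 G H) (a : A) (s t : G) :
    coeff s t (x * S.piRep ρ a) = coeff s t x * ρ.toHom (S.α t⁻¹ a) := by
  classical
  ext ξ
  simp only [coeff_apply, mul_apply_eq_comp, piRep_single]

lemma coeff_mul_lam (ρ : FaithfulRep A H) (x : L2 G H →L[ℂ] L2 G H) (g s t : G) :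
    coeff s t (x * S.lam ρ g) =
      coeff s (g * t) x * ρ.toHom (S.σ (t⁻¹ * g⁻¹) g : A) := by
  classical
  ext ξ
  simp only [coeff_apply, mul_apply_eq_comp, lam_single]

open Classical in
lemma star_lam_single (ρ : FaithfulRep A H) (g t : G) (ξ : H) :
    star (S.lam ρ g) (lp.single 2 t ξ) =
      lp.single 2 (g⁻¹ * t) (ρ.toHom (star (S.σ t⁻¹ g : A)) ξ) := by
  refine ext_inner_right ℂ fun η => ?_
  rw [ContinuousLinearMap.star_eq_adjoint, ContinuousLinearMap.adjoint_inner_left,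
    lp.inner_single_left, lp.inner_single_left, lam_apply, map_star,
    ContinuousLinearMap.star_eq_adjoint, ContinuousLinearMap.adjoint_inner_left]

lemma coeff_mul_star_lam (ρ : FaithfulRep A H) (x : L2 G H →L[ℂ] L2 G H) (g s t : G) :
    coeff s t (x * star (S.lam ρ g)) =
      coeff s (g⁻¹ * t) x * ρ.toHom (star (S.σ t⁻¹ g : A)) := by
  classical
  ext ξ
  simp only [coeff_apply, mul_apply_eq_comp, star_lam_single]

section Induced

variable {I : ClosedIdeal A} (hI : S.IsInvariant I)
  {K : Type*} [NormedAddCommGroup K] [InnerProductSpace ℂ K] [CompleteSpace K]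
  (ρ : FaithfulRep A H) (κ : FaithfulRep I.Quot K)

/-- The graph of the homomorphism `A ⋊ G → A/I ⋊ G` induced by the quotient map: the
C*-algebra generated by all pairs of corresponding generators. -/
def inducedGraph : StarSubalgebra ℂ ((L2 G H →L[ℂ] L2 G H) × (L2 G K →L[ℂ] L2 G K)) :=
  (StarAlgebra.adjoin ℂ
    (Set.range (fun a : A => (S.piRep ρ a, (S.quotient I hI).piRep κ (I.proj a))) ∪
      Set.range (fun g : G => (S.lam ρ g, (S.quotient I hI).lam κ g)))).topologicalClosure

instance : IsClosed (S.inducedGraph hI ρ κ :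
    Set ((L2 G H →L[ℂ] L2 G H) × (L2 G K →L[ℂ] L2 G K))) :=
  StarSubalgebra.isClosed_topologicalClosure _

/-- Corresponding matrix coefficients of a pair in the graph come from one element of `A`. -/
lemma exists_coeff_of_mem_inducedGraph {p : (L2 G H →L[ℂ] L2 G H) × (L2 G K →L[ℂ] L2 G K)}
    (hp : p ∈ S.inducedGraph hI ρ κ) (s t : G) :
    ∃ a : A, ρ.toHom a = coeff s t p.1 ∧ κ.toHom (I.proj a) = coeff s t p.2 := by
  classical
  let M : Set ((L2 G H →L[ℂ] L2 G H) × (L2 G K →L[ℂ] L2 G K)) :=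
    {p | ∀ s t : G, ∃ a : A, ρ.toHom a = coeff s t p.1 ∧ κ.toHom (I.proj a) = coeff s t p.2}
  have hclosed : IsClosed M := by
    let F : A →⋆ₐ[ℂ] (H →L[ℂ] H) × (K →L[ℂ] K) := ρ.toHom.prod (κ.toHom.comp I.proj)
    have hF : Function.Injective F := fun a b h => ρ.injective (congrArg Prod.fst h)
    have hR : IsClosed (Set.range F) :=
      (NonUnitalStarAlgHom.isometry F hF).isClosedEmbedding.isClosed_range
    have : M = ⋂ (s : G) (t : G), (fun p : (L2 G H →L[ℂ] L2 G H) × (L2 G K →L[ℂ] L2 G K) =>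
        (coeff s t p.1, coeff s t p.2)) ⁻¹' Set.range F := by
      ext p
      simp only [M, Set.mem_iInter, Set.mem_preimage, Set.mem_range]
      exact forall_congr' fun s => forall_congr' fun t => exists_congr fun a =>
        (Prod.ext_iff (x := F a) (y := (coeff s t p.1, coeff s t p.2))).symm
    rw [this]
    exact isClosed_iInter fun s => isClosed_iInter fun t => hR.preimage
      (((continuous_coeff s t).comp continuous_fst).prodMk
        ((continuous_coeff s t).comp continuous_snd))
  have hmul : ∀ p ∈ StarAlgebra.adjoin ℂ
      (Set.range (fun a : A => (S.piRep ρ a, (S.quotient I hI).piRep κ (I.proj a))) ∪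
      Set.range (fun g : G => (S.lam ρ g, (S.quotient I hI).lam κ g))),
      ∀ q ∈ M, q * p ∈ M := by
    intro p hp
    change p ∈ Algebra.adjoin ℂ _ at hp
    induction hp using Algebra.adjoin_induction with
    | mem p hp =>
      have hpi : ∀ (a : A), ∀ q ∈ M,
          q * (S.piRep ρ a, (S.quotient I hI).piRep κ (I.proj a)) ∈ M := by
        intro a q hq s t
        obtain ⟨b, hb1, hb2⟩ := hq s t
        refine ⟨b * S.α t⁻¹ a, ?_, ?_⟩
        · simp [coeff_mul_piRep, hb1]
        · simp [coeff_mul_piRep, hb2]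
      rcases hp with (⟨a, rfl⟩ | ⟨g, rfl⟩) | hp
      · exact hpi a
      · intro q hq s t
        obtain ⟨b, hb1, hb2⟩ := hq s (g * t)
        refine ⟨b * S.σ (t⁻¹ * g⁻¹) g, ?_, ?_⟩
        · simp [coeff_mul_lam, hb1]
        · simp [coeff_mul_lam, hb2]
      · rw [Set.mem_star] at hp
        rcases hp with ⟨a, ha⟩ | ⟨g, hg⟩
        · have := hpi (star a)
          rw [map_star, map_star, map_star] at this
          rw [← star_star p, ← ha]
          exact this
        · rw [← star_star p, ← hg]
          intro q hq s t
          obtain ⟨b, hb1, hb2⟩ := hq s (g⁻¹ * t)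
          refine ⟨b * star (S.σ t⁻¹ g : A), ?_, ?_⟩
          · simp only [Prod.fst_mul, Prod.fst_star, coeff_mul_star_lam, hb1, map_mul]
          · simp only [Prod.snd_mul, Prod.snd_star, coeff_mul_star_lam, hb2, map_mul,
              quotient_σ_coe, map_star]
    | algebraMap r =>
      intro q hq s t
      obtain ⟨b, hb1, hb2⟩ := hq s t
      refine ⟨r • b, ?_, ?_⟩
      · simp [Algebra.algebraMap_eq_smul_one, coeff_smul, hb1]
      · simp [Algebra.algebraMap_eq_smul_one, coeff_smul, hb2]
    | add x y _ _ hx hy =>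
      intro q hq s t
      obtain ⟨b, hb1, hb2⟩ := hx q hq s t
      obtain ⟨c, hc1, hc2⟩ := hy q hq s t
      refine ⟨b + c, ?_, ?_⟩
      · simp [mul_add, coeff_add, hb1, hc1]
      · simp [mul_add, coeff_add, hb2, hc2]
    | mul x y _ _ hx hy =>
      intro q hq
      rw [← mul_assoc]
      exact hy _ (hx q hq)
  have hone : (1 : (L2 G H →L[ℂ] L2 G H) × (L2 G K →L[ℂ] L2 G K)) ∈ M := by
    intro s t
    by_cases h : s = t
    · subst h
      refine ⟨1, ?_, ?_⟩ <;> ext ξ <;> simp [coeff_apply]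
    · refine ⟨0, ?_, ?_⟩ <;> ext ξ <;> simp [coeff_apply, h]
  have hsub : (S.inducedGraph hI ρ κ : Set _) ⊆ M :=
    closure_minimal (fun p hp => by simpa using hmul p hp 1 hone) hclosed
  exact hsub hp s t

lemma inducedGraph_injective {p : (L2 G H →L[ℂ] L2 G H) × (L2 G K →L[ℂ] L2 G K)}
    (hp : p ∈ S.inducedGraph hI ρ κ) (h : p.1 = 0) : p.2 = 0 := by
  refine eq_zero_of_coeff _ fun s t => ?_
  obtain ⟨a, h1, h2⟩ := S.exists_coeff_of_mem_inducedGraph hI ρ κ hp s t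
  have h0 : ρ.toHom a = 0 := by
    rw [h1, h]
    rfl
  rw [(map_eq_zero_iff _ ρ.injective).1 h0] at h2
  simpa using h2.symm

lemma fst_mem_of_mem_inducedGraph {p : (L2 G H →L[ℂ] L2 G H) × (L2 G K →L[ℂ] L2 G K)}
    (hp : p ∈ S.inducedGraph hI ρ κ) : p.1 ∈ S.reducedCrossedProduct ρ := by
  have h : S.inducedGraph hI ρ κ ≤ (S.reducedCrossedProduct ρ).comap (StarAlgHom.fst ℂ _ _) := by
    refine StarSubalgebra.topologicalClosure_minimal (StarAlgebra.adjoin_le ?_)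
      ((StarSubalgebra.isClosed_topologicalClosure _).preimage continuous_fst)
    rintro _ (⟨a, rfl⟩ | ⟨g, rfl⟩)
    · exact (S.incl ρ a).2
    · exact (S.lamElem ρ g).2
  exact h hp

lemma snd_mem_of_mem_inducedGraph {p : (L2 G H →L[ℂ] L2 G H) × (L2 G K →L[ℂ] L2 G K)}
    (hp : p ∈ S.inducedGraph hI ρ κ) : p.2 ∈ (S.quotient I hI).reducedCrossedProduct κ := by
  have h : S.inducedGraph hI ρ κ ≤
      ((S.quotient I hI).reducedCrossedProduct κ).comap (StarAlgHom.snd ℂ _ _) := by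
    refine StarSubalgebra.topologicalClosure_minimal (StarAlgebra.adjoin_le ?_)
      ((StarSubalgebra.isClosed_topologicalClosure _).preimage continuous_snd)
    rintro _ (⟨a, rfl⟩ | ⟨g, rfl⟩)
    · exact ((S.quotient I hI).incl κ (I.proj a)).2
    · exact ((S.quotient I hI).lamElem κ g).2
  exact h hp

/-- The first projection of the graph. -/
def graphFst : S.inducedGraph hI ρ κ →⋆ₐ[ℂ] S.Crossed ρ :=
  ((StarAlgHom.fst ℂ _ _).comp (S.inducedGraph hI ρ κ).subtype).codRestrict _
    fun p => S.fst_mem_of_mem_inducedGraph hI ρ κ p.2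

/-- The second projection of the graph. -/
def graphSnd : S.inducedGraph hI ρ κ →⋆ₐ[ℂ] (S.quotient I hI).Crossed κ :=
  ((StarAlgHom.snd ℂ _ _).comp (S.inducedGraph hI ρ κ).subtype).codRestrict _
    fun p => S.snd_mem_of_mem_inducedGraph hI ρ κ p.2

lemma graphFst_bijective : Function.Bijective (S.graphFst hI ρ κ) := by
  have hinj : Function.Injective (S.graphFst hI ρ κ) := by
    rw [injective_iff_map_eq_zero]
    intro p hp
    have h1 : p.1.1 = 0 := congrArg Subtype.val hp
    exact Subtype.ext (Prod.ext h1 (S.inducedGraph_injective hI ρ κ p.2 h1))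
  refine ⟨hinj, fun x => ?_⟩
  let F : S.inducedGraph hI ρ κ →⋆ₐ[ℂ] (L2 G H →L[ℂ] L2 G H) :=
    (StarAlgHom.fst ℂ _ _).comp (S.inducedGraph hI ρ κ).subtype
  have hF : Function.Injective F := fun p q h => hinj (Subtype.ext h)
  have hcl : IsClosed (F.range : Set (L2 G H →L[ℂ] L2 G H)) := by
    exact (NonUnitalStarAlgHom.isometry F hF).isClosedEmbedding.isClosed_range
  have hle : S.reducedCrossedProduct ρ ≤ F.range := by
    refine StarSubalgebra.topologicalClosure_minimal (StarAlgebra.adjoin_le ?_) hcl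
    rintro _ (⟨a, rfl⟩ | ⟨g, rfl⟩)
    · exact ⟨⟨_, StarSubalgebra.le_topologicalClosure _
        (StarAlgebra.subset_adjoin ℂ _ (Or.inl ⟨a, rfl⟩))⟩, rfl⟩
    · exact ⟨⟨_, StarSubalgebra.le_topologicalClosure _
        (StarAlgebra.subset_adjoin ℂ _ (Or.inr ⟨g, rfl⟩))⟩, rfl⟩
  obtain ⟨p, hp⟩ := hle x.2
  exact ⟨p, Subtype.ext hp⟩

/-- The *-homomorphism `A ⋊ G → A/I ⋊ G` induced by the quotient map `A → A/I`. -/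
def inducedHom : S.Crossed ρ →⋆ₐ[ℂ] (S.quotient I hI).Crossed κ :=
  (S.graphSnd hI ρ κ).comp
    ((StarAlgEquiv.ofBijective (S.graphFst hI ρ κ) (S.graphFst_bijective hI ρ κ)).symm :
      S.Crossed ρ →⋆ₐ[ℂ] S.inducedGraph hI ρ κ)

lemma inducedHom_graphFst (p : S.inducedGraph hI ρ κ) :
    S.inducedHom hI ρ κ (S.graphFst hI ρ κ p) = S.graphSnd hI ρ κ p :=
  congrArg (S.graphSnd hI ρ κ)
    ((StarAlgEquiv.ofBijective (S.graphFst hI ρ κ)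
      (S.graphFst_bijective hI ρ κ)).symm_apply_apply p)

lemma inducedHom_incl (a : A) :
    S.inducedHom hI ρ κ (S.incl ρ a) = (S.quotient I hI).incl κ (I.proj a) :=
  S.inducedHom_graphFst hI ρ κ ⟨_, StarSubalgebra.le_topologicalClosure _
    (StarAlgebra.subset_adjoin ℂ _ (Or.inl ⟨a, rfl⟩))⟩

lemma inducedHom_lamElem (g : G) :
    S.inducedHom hI ρ κ (S.lamElem ρ g) = (S.quotient I hI).lamElem κ g :=
  S.inducedHom_graphFst hI ρ κ ⟨_, StarSubalgebra.le_topologicalClosure _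
    (StarAlgebra.subset_adjoin ℂ _ (Or.inr ⟨g, rfl⟩))⟩

lemma continuous_inducedHom : Continuous (S.inducedHom hI ρ κ) := by
  rw [continuous_induced_rng]
  let F : S.Crossed ρ →⋆ₐ[ℂ] (L2 G K →L[ℂ] L2 G K) :=
    ((S.quotient I hI).reducedCrossedProduct κ).subtype.comp (S.inducedHom hI ρ κ)
  have h : ∀ x, ‖F x‖ ≤ 1 * ‖x‖ := fun x => by
    simpa using NonUnitalStarAlgHom.norm_apply_le F x
  exact AddMonoidHomClass.continuous_of_bound F 1 h

end Induced

section CondExp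

variable (ρ : FaithfulRep A H)

lemma exists_coeff (x : S.Crossed ρ) (s t : G) : ∃ a : A, ρ.toHom a = coeff s t x.1 := by
  obtain ⟨I, hI⟩ : ∃ I : ClosedIdeal A, S.IsInvariant I :=
    ⟨⟨⊤, inferInstance, isClosed_univ⟩, fun _ _ _ => trivial⟩
  obtain ⟨p, rfl⟩ := (S.graphFst_bijective hI ρ (universalRep I.Quot)).2 x
  obtain ⟨a, h, -⟩ := S.exists_coeff_of_mem_inducedGraph hI ρ (universalRep I.Quot) p.2 s t
  exact ⟨a, h⟩

/-- The canonical conditional expectation `E : A ⋊ G → A`, the compression of an operator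
to `H ⊗ δ_1`, which lies in (the image of) `A`. -/
def condExp : S.Crossed ρ →ₗ[ℂ] A where
  toFun x := (S.exists_coeff ρ x 1 1).choose
  map_add' x y := ρ.injective <| by
    rw [(S.exists_coeff ρ (x + y) 1 1).choose_spec, map_add,
      (S.exists_coeff ρ x 1 1).choose_spec, (S.exists_coeff ρ y 1 1).choose_spec]
    rfl
  map_smul' c x := ρ.injective <| by
    rw [(S.exists_coeff ρ (c • x) 1 1).choose_spec, map_smul,
      (S.exists_coeff ρ x 1 1).choose_spec]
    rfl

lemma rep_condExp (x : S.Crossed ρ) : ρ.toHom (S.condExp ρ x) = coeff 1 1 x.1 :=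
  (S.exists_coeff ρ x 1 1).choose_spec

lemma condExp_incl (a : A) : S.condExp ρ (S.incl ρ a) = a := by
  classical
  refine ρ.injective ?_
  rw [rep_condExp]
  ext ξ
  rw [coeff_apply]
  change S.piRep ρ a _ _ = _
  simp [piRep_single, α_one]

lemma condExp_incl_mul_lamElem (a : A) {g : G} (hg : g ≠ 1) :
    S.condExp ρ (S.incl ρ a * S.lamElem ρ g) = 0 := by
  classical
  refine ρ.injective ?_
  rw [rep_condExp]
  ext ξ
  rw [coeff_apply]
  change S.piRep ρ a (S.lam ρ g _) _ = _
  simp [lam_single, piRep_single, hg]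

end CondExp

section Ideals

variable (ρ : FaithfulRep A H)

/-- `I ⋊ G`, the (closed two-sided) ideal of `A ⋊ G` generated by `I`. -/
def idealGenerated (I : ClosedIdeal A) : ClosedIdeal (S.Crossed ρ) where
  toIdeal := ⨅ (J : ClosedIdeal (S.Crossed ρ)) (_ : ∀ a ∈ I, S.incl ρ a ∈ J), J.toIdeal
  twoSided := ⟨fun b ha => by
    simp only [Submodule.mem_iInf] at ha ⊢
    intro J hJ
    have := J.twoSided
    exact J.toIdeal.mul_mem_right b (ha J hJ)⟩
  closed := by
    simp only [Submodule.coe_iInf]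
    exact isClosed_iInter fun J => isClosed_iInter fun _ => J.closed

/-- The ideal `ker (A ⋊ G → A/I ⋊ G)` of `A ⋊ G`, for a `G`-invariant ideal `I` of `A`. The
crossed product of `A/I` is formed in the universal representation of `A/I`. -/
def kernelIdeal (I : ClosedIdeal A) (hI : S.IsInvariant I) : ClosedIdeal (S.Crossed ρ) where
  toIdeal := RingHom.ker (S.inducedHom hI ρ (universalRep I.Quot))
  twoSided := inferInstance
  closed := by
    exact isClosed_singleton.preimage (S.continuous_inducedHom hI ρ (universalRep I.Quot))

/-- Exactness: `I ⋊ G = ker (A ⋊ G → A/I ⋊ G)` for every `G`-invariant ideal `I` of `A`. -/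
def IsExact : Prop :=
  ∀ (I : ClosedIdeal A) (hI : S.IsInvariant I), S.idealGenerated ρ I = S.kernelIdeal ρ I hI

/-- Powers' averaging property. -/
def HasPowersAveraging : Prop :=
  ∀ b : S.Crossed ρ, S.condExp ρ b = 0 → ∀ ε : ℝ, 0 < ε →
    ∃ (n : ℕ) (g : Fin n → G), 0 < n ∧
      ‖(n : ℂ)⁻¹ • ∑ i, S.lamElem ρ (g i) * b * star (S.lamElem ρ (g i))‖ < ε

end Ideals

end CrossedProduct

end TwistedSystem

end TwistedCrossed

end

/-! The inverse map is intersection with `A`, that is, `J ↦ {a | π_α(a) ∈ J}`.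

Injectivity: the induced homomorphism sends `π_α(a)` to `π_α(a + Y)`, and `π_α` is faithful on
`A/Y`, so the kernel attached to `Y` meets `A` exactly in `Y` (`incl_mem_kernelIdeal`). Neither
exactness nor averaging is needed here.

Surjectivity: let `J` be an ideal and `Y = J ∩ A`. By exactness the kernel attached to `Y` is the
ideal generated by `Y`, hence is contained in `J`. The reverse inclusion rests on `E(J) ⊆ J`
(`HasPowersAveraging.incl_condExp_mem`): since `α` is trivial, `A` commutes with every `λ_σ(g)`, so
averaging over conjugates fixes `E(x)` and makes `x - E(x)` small. Thus averages of `x ∈ J`, which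
stay in `J`, converge to `E(x)`. For `x ∈ J` all translates `λ_σ(s) x λ_σ(t)` are again in `J`, so
their expectations lie in `Y`. Up to unitaries these expectations are the matrix coefficients of
`x`; hence all coefficients of the image of `x` over `A/Y` vanish, and so does the image
(`mem_kernelIdeal_of_condExp`). -/

namespace TwistedCrossed

namespace TwistedSystem

variable {A G H K : Type*} [CStarAlgebra A] [Group G]
  [NormedAddCommGroup H] [InnerProductSpace ℂ H] [CompleteSpace H]
  [NormedAddCommGroup K] [InnerProductSpace ℂ K] [CompleteSpace K]
  (S : TwistedSystem A G)

/-! ### Consequences of a trivial action: central cocycle, commutation of `A` with `λ_σ(G)` -/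

/-- The cocycle of a trivial twisted action takes central values. -/
lemma IsTrivialAction.σ_mul_comm {S : TwistedSystem A G} (h : S.IsTrivialAction) (r s : G) (a : A) :
    (S.σ r s : A) * a = a * (S.σ r s : A) := by
  have h1 := S.α_comp r s a
  -- For trivial `α` the composition law becomes `a = σ(r,s) a σ(r,s)*`.
  simp only [h _ _] at h1
  have h2 : star (S.σ r s : A) * (S.σ r s : A) = 1 := Unitary.coe_star_mul_self _
  calc (S.σ r s : A) * a
      = (S.σ r s : A) * a * (star (S.σ r s : A) * (S.σ r s : A)) := by rw [h2, mul_one]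
    _ = a * (S.σ r s : A) := by rw [← mul_assoc, ← h1]

/-- For a trivial action, `A` commutes with the elements `λ_σ(g)`. -/
lemma IsTrivialAction.lamElem_mul_incl {S : TwistedSystem A G} (h : S.IsTrivialAction)
    (ρ : FaithfulRep A H) (g : G) (a : A) :
    S.lamElem ρ g * S.incl ρ a = S.incl ρ a * S.lamElem ρ g := by
  apply Subtype.ext
  change S.lam ρ g * S.piRep ρ a = S.piRep ρ a * S.lam ρ g
  ext ξ t
  change S.lam ρ g (S.piRep ρ a ξ) t = S.piRep ρ a (S.lam ρ g ξ) t
  -- At the point `t` the left side carries `α` at `(g⁻¹t)⁻¹` and the right side `α` at `t⁻¹`;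
  -- triviality turns both into `a`, and only the order of `a` and `σ(t⁻¹,g)` still differs.
  rw [lam_apply, piRep_apply, piRep_apply, lam_apply, h, h]
  change (ρ.toHom _ * ρ.toHom _) _ = (ρ.toHom _ * ρ.toHom _) _
  rw [← map_mul, ← map_mul, h.σ_mul_comm]

/-! ### Matrix coefficients and the operators `λ_σ(g)` -/

lemma coeff_lam_mul (ρ : FaithfulRep A H) (x : L2 G H →L[ℂ] L2 G H) (g s t : G) :
    coeff s t (S.lam ρ g * x) = ρ.toHom (S.σ s⁻¹ g : A) * coeff (g⁻¹ * s) t x := rfl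

-- On `ξ ⊗ δ_t` the adjoint moves `t` to `g⁻¹t` with factor `σ(t⁻¹,g)*`, and `λ_σ(g)` moves it back
-- with factor `σ(t⁻¹,g)`. This half of unitarity is what makes conjugation fix elements commuting
-- with `λ_σ(g)`.
open Classical in
lemma lam_mul_star (ρ : FaithfulRep A H) (g : G) : S.lam ρ g * star (S.lam ρ g) = 1 := by
  rw [← sub_eq_zero]
  refine eq_zero_of_coeff _ fun s t => ?_
  ext ξ
  rw [coeff_apply]
  change (S.lam ρ g (star (S.lam ρ g) (lp.single 2 t ξ)) - lp.single 2 t ξ : L2 G H) s = 0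
  rw [star_lam_single, lam_single]
  -- The first argument `(g⁻¹t)⁻¹g⁻¹` simplifies to `t⁻¹`, so the two cocycle values are mutually
  -- inverse unitaries.
  have h : ρ.toHom (S.σ ((g⁻¹ * t)⁻¹ * g⁻¹) g : A) (ρ.toHom (star (S.σ t⁻¹ g : A)) ξ) = ξ := by
    change (ρ.toHom _ * ρ.toHom _) ξ = ξ
    rw [← map_mul]
    simp
  rw [h, mul_inv_cancel_left]
  simp

lemma lamElem_mul_star (ρ : FaithfulRep A H) (g : G) :
    S.lamElem ρ g * star (S.lamElem ρ g) = 1 :=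
  Subtype.ext (S.lam_mul_star ρ g)

lemma incl_injective (ρ : FaithfulRep A H) : Function.Injective (S.incl ρ) :=
  Function.LeftInverse.injective (S.condExp_incl ρ)

/-- Ensures that the intersection of a closed ideal with `A` is closed. -/
lemma continuous_incl (ρ : FaithfulRep A H) : Continuous (S.incl ρ) := by
  rw [continuous_induced_rng]
  refine AddMonoidHomClass.continuous_of_bound (S.piRep ρ) 1 fun a => ?_
  simpa using NonUnitalStarAlgHom.norm_apply_le (S.piRep ρ) a

/-- An operator with vanishing `(1, 1)` coefficients of all its translates is zero. -/
lemma eq_zero_of_coeff_lam_mul_lam (ρ : FaithfulRep A H) (x : L2 G H →L[ℂ] L2 G H)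
    (h : ∀ s t, coeff 1 1 (S.lam ρ s * x * S.lam ρ t) = 0) : x = 0 := by
  refine eq_zero_of_coeff _ fun s t => ?_
  -- Translating by `s⁻¹` on the left and `t` on the right moves the `(s, t)` coefficient to
  -- position `(1, 1)`. The left factor is `σ(1, s⁻¹) = 1`; the right factor `σ(t⁻¹, t)` is a
  -- unitary and is cancelled below.
  have h1 := h s⁻¹ t
  rw [coeff_mul_lam, coeff_lam_mul, inv_one, S.σ_one_left, OneMemClass.coe_one, map_one, one_mul,
    inv_inv, mul_one, mul_one, one_mul] at h1
  have h2 : ρ.toHom (S.σ (t⁻¹) t : A) * ρ.toHom (star (S.σ (t⁻¹) t : A)) = 1 := by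
    rw [← map_mul]
    simp
  calc coeff s t x = coeff s t x * (ρ.toHom (S.σ (t⁻¹) t : A) *
        ρ.toHom (star (S.σ (t⁻¹) t : A))) := by rw [h2, mul_one]
    _ = 0 := by rw [← mul_assoc, h1, zero_mul]

/-! ### Ideals of the crossed product and the conditional expectation -/

/-- The induced homomorphism intertwines the canonical conditional expectations. -/
lemma coeff_inducedHom {I : ClosedIdeal A} (hI : S.IsInvariant I) (ρ : FaithfulRep A H)
    (κ : FaithfulRep I.Quot K) (x : S.Crossed ρ) :
    coeff 1 1 (S.inducedHom hI ρ κ x).1 = κ.toHom (I.proj (S.condExp ρ x)) := by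
  obtain ⟨p, rfl⟩ := (S.graphFst_bijective hI ρ κ).2 x
  rw [inducedHom_graphFst]
  -- A pair in the graph has both of its `(1, 1)` coefficients given by a single `a ∈ A`;
  -- faithfulness of `ρ` forces that `a` to be the conditional expectation.
  obtain ⟨a, h1, h2⟩ := S.exists_coeff_of_mem_inducedGraph hI ρ κ p.2 1 1
  have h3 : S.condExp ρ (S.graphFst hI ρ κ p) = a :=
    ρ.injective ((S.rep_condExp ρ _).trans h1.symm)
  rw [h3]
  exact h2.symm

/-- The ideal of `A` obtained by intersecting an ideal of the crossed product with `A`. -/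
noncomputable def restrictIdeal (ρ : FaithfulRep A H) (J : ClosedIdeal (S.Crossed ρ)) : ClosedIdeal A where
  toIdeal := J.toIdeal.comap (S.incl ρ)
  twoSided := ⟨fun b ha => by
    have := J.twoSided
    rw [Ideal.mem_comap, map_mul]
    exact J.toIdeal.mul_mem_right _ ha⟩
  closed := J.closed.preimage (S.continuous_incl ρ)

lemma mem_kernelIdeal {ρ : FaithfulRep A H} {I : ClosedIdeal A} {hI : S.IsInvariant I}
    {x : S.Crossed ρ} :
    x ∈ S.kernelIdeal ρ I hI ↔ S.inducedHom hI ρ (universalRep I.Quot) x = 0 := Iff.rfl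

/-- Shows that `I` can be recovered from its kernel ideal by intersecting with `A`. It holds because
`A/I` embeds faithfully in its own crossed product. -/
lemma incl_mem_kernelIdeal (ρ : FaithfulRep A H) (I : ClosedIdeal A) (hI : S.IsInvariant I)
    (a : A) : S.incl ρ a ∈ S.kernelIdeal ρ I hI ↔ a ∈ I := by
  rw [mem_kernelIdeal, inducedHom_incl, ← I.proj_eq_zero_iff]
  exact map_eq_zero_iff _ (incl_injective _ _)

/-- `x` lies in the kernel ideal as soon as the conditional expectations of all translates of `x`
lie in `I`. -/
lemma mem_kernelIdeal_of_condExp (ρ : FaithfulRep A H) (I : ClosedIdeal A) (hI : S.IsInvariant I)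
    (x : S.Crossed ρ)
    (h : ∀ s t, S.condExp ρ (S.lamElem ρ s * x * S.lamElem ρ t) ∈ I) :
    x ∈ S.kernelIdeal ρ I hI := by
  rw [mem_kernelIdeal]
  refine Subtype.ext
    ((S.quotient I hI).eq_zero_of_coeff_lam_mul_lam (universalRep I.Quot) _ fun s t => ?_)
  -- The `(1, 1)` coefficient of the image of a translate is the class of its expectation modulo
  -- `I`, hence zero; the image of the translate is the corresponding translate of the image of `x`.
  have h1 := S.coeff_inducedHom hI ρ (universalRep I.Quot) (S.lamElem ρ s * x * S.lamElem ρ t)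
  rw [I.proj_eq_zero_iff.2 (h s t), map_zero, map_mul, map_mul, inducedHom_lamElem,
    inducedHom_lamElem] at h1
  exact h1

/-- Averages of conjugates of `x` remain in `J`. Their distance to `E(x)` is the norm of the
averaged `x - E(x)`, because `E(x)` commutes with the `λ_σ(g)`. Powers' property makes this
arbitrarily small, and `J` is closed. -/
lemma HasPowersAveraging.incl_condExp_mem {S : TwistedSystem A G} {ρ : FaithfulRep A H}
    (hpowers : S.HasPowersAveraging ρ) (htriv : S.IsTrivialAction)
    (J : ClosedIdeal (S.Crossed ρ)) {x : S.Crossed ρ} (hx : x ∈ J) :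
    S.incl ρ (S.condExp ρ x) ∈ J := by
  have := J.twoSided
  set e := S.incl ρ (S.condExp ρ x) with he
  suffices h : e ∈ closure (J.toIdeal : Set (S.Crossed ρ)) by
    rwa [J.closed.closure_eq] at h
  rw [Metric.mem_closure_iff]
  intro ε hε
  -- Averaging applies to `x - e` since `E` restricts to the identity on `A`.
  obtain ⟨n, g, hn, hlt⟩ := hpowers (x - e) (by rw [map_sub, he, condExp_incl, sub_self]) ε hε
  have hn0 : (n : ℂ) ≠ 0 := by exact_mod_cast hn.ne'
  refine ⟨(n : ℂ)⁻¹ • ∑ i, S.lamElem ρ (g i) * x * star (S.lamElem ρ (g i)), ?_, ?_⟩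
  · exact Submodule.smul_of_tower_mem J.toIdeal _ <| Submodule.sum_mem _ fun i _ =>
      J.toIdeal.mul_mem_right _ (J.toIdeal.mul_mem_left _ hx)
  · have hterm : ∀ i, S.lamElem ρ (g i) * (x - e) * star (S.lamElem ρ (g i)) =
        S.lamElem ρ (g i) * x * star (S.lamElem ρ (g i)) - e := fun i => by
      rw [mul_sub, sub_mul, he, htriv.lamElem_mul_incl, mul_assoc (S.incl ρ _),
        S.lamElem_mul_star, mul_one]
    -- The `n` copies of `e` average back to `e`, which uses `n ≠ 0`; `hlt` then bounds the distance
    -- from the average of `x` to `e`.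
    rw [Finset.sum_congr rfl fun i _ => hterm i, Finset.sum_sub_distrib, smul_sub,
      Finset.sum_const, Finset.card_univ, Fintype.card_fin, ← Nat.cast_smul_eq_nsmul ℂ,
      inv_smul_smul₀ hn0] at hlt
    rw [dist_comm, dist_eq_norm]
    exact hlt

end TwistedSystem

end TwistedCrossed

/-! ### The bijection -/

theorem mainTheorem9 {A G H : Type*} [CStarAlgebra A] [Group G]
    [NormedAddCommGroup H] [InnerProductSpace ℂ H] [CompleteSpace H]
    (S : TwistedCrossed.TwistedSystem A G) (ρ : TwistedCrossed.FaithfulRep A H)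
    (htriv : S.IsTrivialAction) (hexact : S.IsExact ρ) (hpowers : S.HasPowersAveraging ρ) :
    Function.Bijective
      (fun Y : TwistedCrossed.ClosedIdeal A => S.kernelIdeal ρ Y (htriv.isInvariant Y)) := by
  refine ⟨fun Y Z h => SetLike.ext fun a => ?_, fun J => ?_⟩
  · rw [← S.incl_mem_kernelIdeal ρ Y (htriv.isInvariant Y),
      ← S.incl_mem_kernelIdeal ρ Z (htriv.isInvariant Z)]
    exact iff_of_eq (congrArg (fun J => S.incl ρ a ∈ J) h)
  · have := J.twoSided
    -- The preimage of `J` is its intersection with `A`; its invariance is automatic for a trivial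
    -- action.
    refine ⟨S.restrictIdeal ρ J, SetLike.ext fun x => ⟨fun hx => ?_, fun hx => ?_⟩⟩
    · change x ∈ S.kernelIdeal ρ _ _ at hx
      -- The only use of exactness: the generated ideal is an infimum over all ideals containing `J
      -- ∩ A`, and `J` is one of these by the very definition of the restriction.
      rw [← hexact] at hx
      have h1 : x ∈ (S.idealGenerated ρ (S.restrictIdeal ρ J)).toIdeal := hx
      exact (Submodule.mem_iInf _).1 ((Submodule.mem_iInf _).1 h1 J) fun a ha => ha
    -- Translates of `x` stay in the two-sided ideal `J`, so averaging puts their expectations in `J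
    -- ∩ A`.
    · exact S.mem_kernelIdeal_of_condExp ρ _ _ x fun s t =>
        hpowers.incl_condExp_mem htriv J
          (J.toIdeal.mul_mem_right _ (J.toIdeal.mul_mem_left _ hx))
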